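/- Let $G=(V,E)$ be a finite simple graph with $n=|V|\ge 1$ vertices and $m=|E|$ edges, adjacency matrix $A$ and diagonal degree matrix $D$. Let $\mu_1\ge\dots\ge\mu_n$, $\theta_1\ge\dots\ge\theta_n$ and $\delta_1\ge\dots\ge\delta_n$ be the eigenvalues of $A$, of the Laplacian $D-A$ and of the signless Laplacian $D+A$, respectively. The orthogonal rank $\xi(G)$ is the smallest positive integer $d$ for which there are non-zero vectors $x_v\in\mathbb{C}^d$ $(v\in V)$ with $x_v^\dagger x_w=0$ for all $vw\in E$. A vectorial $c$-coloring of $G$ is a family of vectors $(x_{v,i})_{v\in V,\,0\le i<c}$ in a complex Hilbert space such that $\langle x_{v,i},x_{w,j}\rangle\ge 0$ for all $v,w\in V$ and all $i,j$; $\sum_i x_{v,i}=\sum_i x_{w,i}$ and $\bigl\|\sum_i x_{v,i}\bigr\|=1$ for all $v,w\in V$; $\langle x_{v,i},x_{v,j}\rangle=0$ for all $v\in V$ and $i\ne j$; and $\langle x_{v,i},x_{w,i}\rangle=0$ for all $vw\in E$ and all $i$. The vectorial chromatic number $\chi_{\mathrm{vect}}(G)$ is the least $c$ for which $G$ has a vectorial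 $c$-coloring. Then \[ 1+\max\left(\frac{\mu_1}{|\mu_n|},\ \frac{2m}{2m-n\delta_n},\ \frac{\mu_1}{\mu_1-\delta_1+\theta_1}\right)\ \le\ \chi_{\mathrm{vect}}(G)\ \le\ \xi(G). \] If $G$ has at least one edge, the three denominators are positive; if $G$ has no edge, each quotient is $0/0$ and is read as $0$. -/

import Mathlib

namespace SimpleGraph

section Parameters

variable {V : Type*} (G : SimpleGraph V)

/-- An orthogonal representation of `G` in `ℂ^d`: nonzero vectors, one for each vertex, such that
adjacent vertices receive orthogonal vectors. -/
structure IsOrthogonalRep (d : ℕ) (x : V → EuclideanSpace ℂ (Fin d)) : Prop where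
  ne_zero : ∀ v, x v ≠ 0
  inner_eq_zero : ∀ v w, G.Adj v w → inner ℂ (x v) (x w) = 0

/-- The orthogonal rank `ξ(G)`: the smallest positive `d` such that `G` has an orthogonal
representation in `ℂ^d`. -/
noncomputable def orthogonalRank : ℕ :=
  sInf {d : ℕ | 0 < d ∧ ∃ x : V → EuclideanSpace ℂ (Fin d), G.IsOrthogonalRep d x}

open scoped ComplexOrder in
/-- A vectorial `c`-coloring of `G` in the Hilbert space `H`. In `inner_nonneg` the order is that
of `ℂ`: the inner product is real and nonnegative. -/
structure IsVectorialColoring (c : ℕ) {H : Type*} [NormedAddCommGroup H] [InnerProductSpace ℂ H]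
    (x : V → Fin c → H) : Prop where
  inner_nonneg : ∀ v w i j, 0 ≤ inner ℂ (x v i) (x w j)
  sum_eq_sum : ∀ v w, ∑ i, x v i = ∑ i, x w i
  norm_sum : ∀ v, ‖∑ i, x v i‖ = 1
  inner_self_eq_zero : ∀ v i j, i ≠ j → inner ℂ (x v i) (x v j) = 0
  inner_adj_eq_zero : ∀ v w, G.Adj v w → ∀ i, inner ℂ (x v i) (x w i) = 0

/-- `G` has a vectorial `c`-coloring in some Hilbert space. (For finite `G` the vectors span a
finite-dimensional space, so the universe of `H` is immaterial.) -/
def VectoriallyColorable (c : ℕ) : Prop :=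
  ∃ (H : Type) (_ : NormedAddCommGroup H) (_ : InnerProductSpace ℂ H) (_ : CompleteSpace H)
    (x : V → Fin c → H), G.IsVectorialColoring c x

/-- The vectorial chromatic number: the least `c` such that `G` has a vectorial `c`-coloring. -/
noncomputable def vectorialChromaticNumber : ℕ :=
  sInf {c : ℕ | G.VectoriallyColorable c}

/-- The set whose minimum is the orthogonal rank is nonempty. -/
theorem exists_isOrthogonalRep [Fintype V] [Nonempty V] :
    {d : ℕ | 0 < d ∧ ∃ x : V → EuclideanSpace ℂ (Fin d), G.IsOrthogonalRep d x}.Nonempty := by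
  refine ⟨Fintype.card V, Fintype.card_pos,
    fun v => EuclideanSpace.single (Fintype.equivFin V v) 1, ?_, ?_⟩
  · intro v h
    simpa using congrArg norm h
  · intro v w h
    have h' : Fintype.equivFin V v ≠ Fintype.equivFin V w := fun e =>
      h.ne ((Fintype.equivFin V).injective e)
    simp [EuclideanSpace.inner_single_left, h']

open scoped ComplexOrder in
/-- The set whose minimum is the vectorial chromatic number is nonempty. -/
theorem exists_vectoriallyColorable [Fintype V] :
    {c : ℕ | G.VectoriallyColorable c}.Nonempty := by
  refine ⟨Fintype.card V, ℂ, inferInstance, inferInstance, inferInstance,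
    fun v i => if i = Fintype.equivFin V v then 1 else 0, ?_, ?_, ?_, ?_, ?_⟩
  · intro v w i j
    split_ifs <;> simp
  · intro v w
    simp
  · intro v
    simp
  · intro v i j h
    split_ifs with h1 h2
    · exact absurd (h1.trans h2.symm) h
    all_goals simp
  · intro v w h i
    split_ifs with h1 h2
    · exact absurd ((Fintype.equivFin V).injective (h1.symm.trans h2)) h.ne
    all_goals simp

end Parameters

section Spectra

variable {V : Type*} [Fintype V] [DecidableEq V] (G : SimpleGraph V) [DecidableRel G.Adj]

/-- The signless Laplacian `Q = D + A`. -/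
def signlessLapMatrix : Matrix V V ℝ := G.degMatrix ℝ + G.adjMatrix ℝ

theorem isHermitian_signlessLapMatrix : G.signlessLapMatrix.IsHermitian :=
  (G.isHermitian_degMatrix ℝ).add (G.isHermitian_adjMatrix ℝ)

/-- The eigenvalues `μ` of the adjacency matrix, with multiplicity, in nonincreasing order. -/
noncomputable def adjEigenvalues : Fin (Fintype.card V) → ℝ :=
  (G.isHermitian_adjMatrix ℝ).eigenvalues₀

/-- The eigenvalues `θ` of the Laplacian `D - A`, with multiplicity, in nonincreasing order. -/
noncomputable def lapEigenvalues : Fin (Fintype.card V) → ℝ :=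
  (G.isHermitian_lapMatrix ℝ).eigenvalues₀

/-- The eigenvalues `δ` of the signless Laplacian `D + A`, with multiplicity, in nonincreasing
order. -/
noncomputable def signlessLapEigenvalues : Fin (Fintype.card V) → ℝ :=
  G.isHermitian_signlessLapMatrix.eigenvalues₀

end Spectra

/-- The position of the first (largest) eigenvalue in a list indexed by `Fin |V|`. -/
def firstIdx (V : Type*) [Fintype V] [Nonempty V] : Fin (Fintype.card V) :=
  ⟨0, Fintype.card_pos⟩

/-- The position of the last (smallest) eigenvalue in a list indexed by `Fin |V|`. -/
def lastIdx (V : Type*) [Fintype V] [Nonempty V] : Fin (Fintype.card V) :=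
  ⟨Fintype.card V - 1, Nat.sub_lt Fintype.card_pos Nat.one_pos⟩

end SimpleGraph

/-! Lower bounds: let `M` be the matrix of the sums `∑ i, ⟨x v i, x w i⟩` over a vectorial
`c`-coloring. Then `N = c M - J` is positive semidefinite, with diagonal `c - 1` and entry `-1` on
every edge. If `diag b + A` is positive semidefinite, the Schur product theorem makes its Hadamard
product with `N`, which is `(c - 1) diag b - A`, positive semidefinite too. The three bounds come
from testing this on a vector `z`: `b = -μₙ` with `z` a top eigenvector of `A`; `b = deg - δₙ` with
`z` the all-ones vector; `b = θ₁ - deg` with `z` a top eigenvector of `D + A`.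

Upper bound: normalize an orthogonal representation in `ℂ^d` to unit vectors `u v`. Tensoring the
centered basis vector `e_i - 1/d` with the traceless part of `u u†`, and adding a common scalar
coordinate, gives a vectorial `d`-coloring for a suitable scaling. -/

namespace Matrix.IsHermitian

/-! ### Extreme eigenvalues and semidefinite shifts of a real symmetric matrix -/

variable {n : Type*} [Fintype n] [DecidableEq n] {A : Matrix n n ℝ} (hA : A.IsHermitian)

theorem posSemidef_sub_smul_one {r : ℝ} (h : ∀ i, r ≤ hA.eigenvalues i) :
    (A - r • (1 : Matrix n n ℝ)).PosSemidef := by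
  have key : A - r • (1 : Matrix n n ℝ) = Unitary.conjStarAlgAut ℝ _ hA.eigenvectorUnitary
      (diagonal fun i => hA.eigenvalues i - r) := by
    have hd : (diagonal fun i => hA.eigenvalues i - r)
        = diagonal (RCLike.ofReal ∘ hA.eigenvalues) - r • (1 : Matrix n n ℝ) := by
      rw [smul_one_eq_diagonal, diagonal_sub]
      rfl
    rw [hd, map_sub, map_smul, map_one, ← hA.spectral_theorem]
  rw [key, Unitary.conjStarAlgAut_apply]
  exact (PosSemidef.diagonal fun i => sub_nonneg.2 (h i)).mul_mul_conjTranspose_same _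

theorem posSemidef_smul_one_sub {r : ℝ} (h : ∀ i, hA.eigenvalues i ≤ r) :
    (r • (1 : Matrix n n ℝ) - A).PosSemidef := by
  have key : r • (1 : Matrix n n ℝ) - A = Unitary.conjStarAlgAut ℝ _ hA.eigenvectorUnitary
      (diagonal fun i => r - hA.eigenvalues i) := by
    have hd : (diagonal fun i => r - hA.eigenvalues i)
        = r • (1 : Matrix n n ℝ) - diagonal (RCLike.ofReal ∘ hA.eigenvalues) := by
      rw [smul_one_eq_diagonal, diagonal_sub]
      rfl
    rw [hd, map_sub, map_smul, map_one, ← hA.spectral_theorem]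
  rw [key, Unitary.conjStarAlgAut_apply]
  exact (PosSemidef.diagonal fun i => sub_nonneg.2 (h i)).mul_mul_conjTranspose_same _

theorem exists_unit_eigenvector_eigenvalues₀ (k : Fin (Fintype.card n)) :
    ∃ z : n → ℝ, z ⬝ᵥ z = 1 ∧ A *ᵥ z = hA.eigenvalues₀ k • z := by
  let e : Fin (Fintype.card n) ≃ n := Fintype.equivOfCardEq (Fintype.card_fin _)
  refine ⟨hA.eigenvectorBasis (e k), ?_, ?_⟩
  · have h := hA.eigenvectorBasis.orthonormal.1 (e k)
    rw [EuclideanSpace.norm_eq, Real.sqrt_eq_one] at h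
    simpa [dotProduct, sq] using h
  · have h := hA.mulVec_eigenvectorBasis (e k)
    simpa [eigenvalues, e] using h

theorem posSemidef_eigenvalues₀_firstIdx [Nonempty n] :
    (hA.eigenvalues₀ (SimpleGraph.firstIdx n) • (1 : Matrix n n ℝ) - A).PosSemidef :=
  hA.posSemidef_smul_one_sub fun _ => hA.eigenvalues₀_antitone (Nat.zero_le _)

theorem posSemidef_sub_eigenvalues₀_lastIdx [Nonempty n] :
    (A - hA.eigenvalues₀ (SimpleGraph.lastIdx n) • (1 : Matrix n n ℝ)).PosSemidef :=
  hA.posSemidef_sub_smul_one fun _ => hA.eigenvalues₀_antitone (Nat.le_sub_one_of_lt (Fin.is_lt _))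

theorem dotProduct_mulVec_le_eigenvalues₀_firstIdx [Nonempty n] (z : n → ℝ) :
    z ⬝ᵥ A *ᵥ z ≤ hA.eigenvalues₀ (SimpleGraph.firstIdx n) * (z ⬝ᵥ z) := by
  have h := hA.posSemidef_eigenvalues₀_firstIdx.dotProduct_mulVec_nonneg z
  simp only [star_trivial, sub_mulVec, smul_mulVec, one_mulVec, dotProduct_sub, dotProduct_smul,
    smul_eq_mul] at h
  linarith

end Matrix.IsHermitian

namespace SimpleGraph

open Matrix

/-! ### Spectral lower bounds for the vectorial chromatic number -/

section LowerBounds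

variable {V : Type*} {G : SimpleGraph V} {c : ℕ}

/-- The matrix `c M - J`, where `M` is the Gram matrix of a vectorial `c`-coloring. -/
theorem VectoriallyColorable.exists_posSemidef [Fintype V] (h : G.VectoriallyColorable c) :
    ∃ N : Matrix V V ℝ, N.PosSemidef ∧ (∀ v, N v v = c - 1) ∧ ∀ v w, G.Adj v w → N v w = -1 := by
  obtain ⟨H, _, _, _, x, hx⟩ := h
  have hsum : ∀ v w, ∑ i, (inner ℂ (x v i) (∑ j, x w j)) = 1 := by
    intro v w
    rw [← sum_inner, hx.sum_eq_sum v w, inner_self_eq_norm_sq_to_K, hx.norm_sum]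
    simp
  have hdiag : ∀ v, ∑ i, inner ℂ (x v i) (x v i) = 1 := by
    intro v
    rw [← hsum v v]
    refine Finset.sum_congr rfl fun i _ => ?_
    rw [inner_sum, Finset.sum_eq_single i (fun j _ hj => hx.inner_self_eq_zero v i j hj.symm)
      (by simp)]
  -- The Gram sums of the `y v i` are `c (c M - J)`, which exhibits `c M - J` as positive
  -- semidefinite.
  let y : V → Fin c → H := fun v i => (c : ℂ) • x v i - ∑ j, x v j
  have hy : ∀ v w, ∑ i, inner ℂ (y v i) (y w i)
      = c * (c * ∑ i, inner ℂ (x v i) (x w i) - 1) := by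
    intro v w
    have h1 : ∑ i, inner ℂ (∑ j, x v j) (x w i) = 1 := by
      rw [← inner_sum, hx.sum_eq_sum v w, inner_self_eq_norm_sq_to_K, hx.norm_sum]
      simp
    have h2 : inner ℂ (∑ j, x v j) (∑ j, x w j) = 1 := by
      rw [hx.sum_eq_sum v w, inner_self_eq_norm_sq_to_K, hx.norm_sum]
      simp
    simp only [y, inner_sub_left, inner_sub_right, inner_smul_left, inner_smul_right,
      Finset.sum_sub_distrib, ← Finset.mul_sum, h1, h2, hsum]
    simp
  -- With a vertex present, `c = 0` would make an empty sum have norm 1.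
  have hc : (c : ℝ)⁻¹ * c = 1 ∨ IsEmpty V := by
    rcases isEmpty_or_nonempty V with hV | ⟨⟨v⟩⟩
    · exact Or.inr hV
    · left
      refine inv_mul_cancel₀ ?_
      rintro h0
      have : c = 0 := by exact_mod_cast h0
      subst this
      simpa using hx.norm_sum v
  let N : Matrix V V ℝ := Matrix.of fun v w => (c : ℝ)⁻¹ * ∑ i, (inner ℂ (y v i) (y w i)).re
  have hN : ∀ v w, N v w = c * (∑ i, inner ℂ (x v i) (x w i)).re - 1 := by
    intro v w
    have hc' := hc.resolve_right (fun h => h.elim v)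
    have := congrArg Complex.re (hy v w)
    rw [Complex.re_sum, ← Complex.ofReal_natCast, Complex.re_ofReal_mul, Complex.sub_re,
      Complex.re_ofReal_mul] at this
    simp only [N, Matrix.of_apply, this, ← mul_assoc, hc', one_mul, Complex.one_re]
  refine ⟨N, ?_, ?_, ?_⟩
  · refine PosSemidef.of_dotProduct_mulVec_nonneg ?_ ?_
    · ext v w
      simp only [N, conjTranspose_apply, Matrix.of_apply, star_trivial]
      congr 1
      exact Finset.sum_congr rfl fun i _ => inner_re_symm (𝕜 := ℂ) _ _
    · intro z
      have : star z ⬝ᵥ N *ᵥ z = (c : ℝ)⁻¹ * ∑ i, ‖∑ v, (z v : ℂ) • y v i‖ ^ 2 := by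
        have hi : ∀ i, ‖∑ v, (z v : ℂ) • y v i‖ ^ 2
            = ∑ v, ∑ w, z v * (z w * (inner ℂ (y v i) (y w i)).re) := by
          intro i
          rw [← inner_self_eq_norm_sq (𝕜 := ℂ), sum_inner, map_sum]
          refine Finset.sum_congr rfl fun v _ => ?_
          rw [inner_sum, map_sum]
          refine Finset.sum_congr rfl fun w _ => ?_
          rw [inner_smul_left, inner_smul_right]
          simp
        simp only [hi, dotProduct, mulVec, star_trivial, N, Matrix.of_apply]
        rw [Finset.sum_comm, Finset.mul_sum]
        refine Finset.sum_congr rfl fun v _ => ?_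
        rw [Finset.sum_comm, Finset.mul_sum, Finset.mul_sum]
        refine Finset.sum_congr rfl fun w _ => ?_
        rw [← Finset.mul_sum, ← Finset.mul_sum]
        ring
      rw [this]
      positivity
  · intro v
    rw [hN, hdiag]
    simp
  · intro v w hvw
    rw [hN, Finset.sum_eq_zero fun i _ => hx.inner_adj_eq_zero v w hvw i]
    simp

theorem VectoriallyColorable.pos [Nonempty V] (h : G.VectoriallyColorable c) : 1 ≤ c := by
  obtain ⟨H, _, _, _, x, hx⟩ := h
  rcases Nat.eq_zero_or_pos c with rfl | hc
  · simpa using hx.norm_sum (Classical.arbitrary V)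
  · exact hc

/-- With one color all vertices share a single unit vector, which an edge would make orthogonal to
itself. -/
theorem VectoriallyColorable.two_le (h : G.VectoriallyColorable c) (hG : G ≠ ⊥) : 2 ≤ c := by
  obtain ⟨v, w, hvw⟩ := ne_bot_iff_exists_adj.1 hG
  obtain ⟨H, _, _, _, x, hx⟩ := h
  by_contra! hc
  interval_cases c
  · simpa using hx.norm_sum v
  · have h1 := hx.inner_adj_eq_zero v w hvw 0
    have h2 := hx.sum_eq_sum v w
    have h3 := hx.norm_sum v
    simp only [Fin.sum_univ_one] at h2 h3
    rw [← h2, inner_self_eq_zero] at h1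
    simp [h1] at h3

variable [Fintype V] [DecidableEq V] [DecidableRel G.Adj]

/-- Schur product with `N`: the entries of `N` off the diagonal and off the edges are unknown, but
there `diag b + A` vanishes. -/
theorem VectoriallyColorable.dotProduct_adjMatrix_mulVec_le (h : G.VectoriallyColorable c)
    {b : V → ℝ} (hb : (diagonal b + G.adjMatrix ℝ).PosSemidef) (z : V → ℝ) :
    z ⬝ᵥ G.adjMatrix ℝ *ᵥ z ≤ (c - 1) * ∑ v, b v * z v ^ 2 := by
  obtain ⟨N, hN, hd, ho⟩ := h.exists_posSemidef
  have hNB : N ⊙ (diagonal b + G.adjMatrix ℝ) = ((c : ℝ) - 1) • diagonal b - G.adjMatrix ℝ := by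
    ext v w
    by_cases hvw : v = w
    · subst hvw
      simp [hd]
    · by_cases ha : G.Adj v w
      · simp [hvw, ha, ho v w ha]
      · simp [hvw, ha]
  have h0 := (hN.hadamard hb).dotProduct_mulVec_nonneg z
  rw [hNB] at h0
  simp only [star_trivial, sub_mulVec, smul_mulVec, dotProduct_sub, dotProduct_smul,
    smul_eq_mul] at h0
  have h1 : z ⬝ᵥ diagonal b *ᵥ z = ∑ v, b v * z v ^ 2 := by
    simp only [dotProduct, mulVec_diagonal]
    exact Finset.sum_congr rfl fun v _ => by ring
  rw [h1] at h0
  linarith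

theorem VectoriallyColorable.adjEigenvalues_le [Nonempty V] (h : G.VectoriallyColorable c) :
    G.adjEigenvalues (firstIdx V) ≤ (c - 1) * -G.adjEigenvalues (lastIdx V) := by
  obtain ⟨z, hz, hAz⟩ :=
    (G.isHermitian_adjMatrix ℝ).exists_unit_eigenvector_eigenvalues₀ (firstIdx V)
  have hb : (diagonal (fun _ => -G.adjEigenvalues (lastIdx V)) + G.adjMatrix ℝ).PosSemidef := by
    convert (G.isHermitian_adjMatrix ℝ).posSemidef_sub_eigenvalues₀_lastIdx using 1
    rw [smul_one_eq_diagonal, sub_eq_add_neg, add_comm, diagonal_neg]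
    rfl
  have := h.dotProduct_adjMatrix_mulVec_le hb z
  rw [hAz, dotProduct_smul, hz, ← Finset.mul_sum] at this
  have hz' : ∑ v, z v ^ 2 = 1 := by simpa [dotProduct, sq] using hz
  simpa [adjEigenvalues, hz'] using this

theorem VectoriallyColorable.two_mul_card_edgeFinset_le [Nonempty V]
    (h : G.VectoriallyColorable c) :
    2 * (G.edgeFinset.card : ℝ) ≤ (c - 1) * (2 * (G.edgeFinset.card : ℝ)
      - Fintype.card V * G.signlessLapEigenvalues (lastIdx V)) := by
  have hb : (diagonal (fun v => (G.degree v : ℝ) - G.signlessLapEigenvalues (lastIdx V))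
      + G.adjMatrix ℝ).PosSemidef := by
    convert G.isHermitian_signlessLapMatrix.posSemidef_sub_eigenvalues₀_lastIdx using 1
    rw [smul_one_eq_diagonal]
    change _ = diagonal _ + _ - _
    rw [add_sub_right_comm, diagonal_sub]
    rfl
  have hdeg : ∑ v, (G.degree v : ℝ) = 2 * (G.edgeFinset.card : ℝ) := by
    exact_mod_cast G.sum_degrees_eq_twice_card_edges
  have := h.dotProduct_adjMatrix_mulVec_le hb (fun _ => 1)
  have h1 : (fun _ => 1 : V → ℝ) ⬝ᵥ G.adjMatrix ℝ *ᵥ (fun _ => 1)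
      = 2 * (G.edgeFinset.card : ℝ) := by
    rw [← hdeg]
    simp [dotProduct, adjMatrix_mulVec_apply]
  simpa [h1, hdeg, Finset.sum_sub_distrib] using this

theorem VectoriallyColorable.adjEigenvalues_le_mul [Nonempty V] (h : G.VectoriallyColorable c)
    (hc : 2 ≤ c) :
    G.adjEigenvalues (firstIdx V) ≤ (c - 1) * (G.adjEigenvalues (firstIdx V)
      - G.signlessLapEigenvalues (firstIdx V) + G.lapEigenvalues (firstIdx V)) := by
  obtain ⟨z, hz, hQz⟩ :=
    G.isHermitian_signlessLapMatrix.exists_unit_eigenvector_eigenvalues₀ (firstIdx V)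
  have hb : (diagonal (fun v => G.lapEigenvalues (firstIdx V) - (G.degree v : ℝ))
      + G.adjMatrix ℝ).PosSemidef := by
    convert (G.isHermitian_lapMatrix ℝ).posSemidef_eigenvalues₀_firstIdx using 1
    rw [smul_one_eq_diagonal]
    change _ = _ - (diagonal _ - _)
    rw [← sub_add, diagonal_sub]
    rfl
  have h1 := h.dotProduct_adjMatrix_mulVec_le hb z
  have h2 : z ⬝ᵥ G.adjMatrix ℝ *ᵥ z ≤ G.adjEigenvalues (firstIdx V) := by
    simpa [hz, adjEigenvalues] using
      (G.isHermitian_adjMatrix ℝ).dotProduct_mulVec_le_eigenvalues₀_firstIdx z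
  have h3 : z ⬝ᵥ G.degMatrix ℝ *ᵥ z + z ⬝ᵥ G.adjMatrix ℝ *ᵥ z
      = G.signlessLapEigenvalues (firstIdx V) := by
    rw [← dotProduct_add, ← add_mulVec]
    change z ⬝ᵥ G.signlessLapMatrix *ᵥ z = _
    rw [hQz, dotProduct_smul, hz]
    simp [signlessLapEigenvalues]
  have h4 : ∑ v, (G.lapEigenvalues (firstIdx V) - (G.degree v : ℝ)) * z v ^ 2
      = G.lapEigenvalues (firstIdx V) - z ⬝ᵥ G.degMatrix ℝ *ᵥ z := by
    have hz' : ∑ v, z v ^ 2 = 1 := by simpa [dotProduct, sq] using hz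
    simp only [sub_mul, Finset.sum_sub_distrib, ← Finset.mul_sum, hz', mul_one]
    congr 1
    simp only [dotProduct, degMatrix, mulVec_diagonal]
    exact Finset.sum_congr rfl fun v _ => by ring
  rw [h4] at h1
  have hc' : (2 : ℝ) ≤ c := by exact_mod_cast hc
  -- With `a = zᵀ A z`, the bound reads `a ≤ (c - 1) (a - δ₁ + θ₁)`. Replacing `a` by `μ₁ ≥ a` adds
  -- `(c - 2) (μ₁ - a)` to the slack, which is nonnegative because `c ≥ 2`.
  nlinarith [mul_nonneg (sub_nonneg.2 hc') (sub_nonneg.2 h2)]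

theorem adjEigenvalues_firstIdx_pos [Nonempty V] (hG : G ≠ ⊥) :
    0 < G.adjEigenvalues (firstIdx V) := by
  obtain ⟨v, w, hvw⟩ := ne_bot_iff_exists_adj.1 hG
  -- The indicator of the two ends of an edge has Rayleigh quotient 1.
  have h := (G.isHermitian_adjMatrix ℝ).dotProduct_mulVec_le_eigenvalues₀_firstIdx
    (Pi.single v 1 + Pi.single w 1)
  simp [mulVec_add, hvw, hvw.symm, hvw.ne, hvw.ne'] at h
  unfold adjEigenvalues
  linarith

theorem adjEigenvalues_bot [DecidableRel (⊥ : SimpleGraph V).Adj] (k : Fin (Fintype.card V)) :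
    (⊥ : SimpleGraph V).adjEigenvalues k = 0 := by
  obtain ⟨z, hz, hAz⟩ :=
    ((⊥ : SimpleGraph V).isHermitian_adjMatrix ℝ).exists_unit_eigenvector_eigenvalues₀ k
  have h0 : (⊥ : SimpleGraph V).adjMatrix ℝ = 0 := by
    ext v w
    simp
  have := congrArg (z ⬝ᵥ ·) hAz
  simp only [dotProduct_smul, hz, smul_eq_mul, mul_one] at this
  rw [adjEigenvalues, ← this, h0]
  simp

end LowerBounds

/-! ### Vectorial colorings from orthogonal representations -/

section UpperBound

open scoped TensorProduct

variable {d : ℕ}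

/-- The standard basis vector `e_i`, projected onto the complement of the all-ones vector. -/
noncomputable def centeredBasisVec (i : Fin d) : EuclideanSpace ℂ (Fin d) :=
  WithLp.toLp 2 fun a => (if a = i then 1 else 0) - (d : ℂ)⁻¹

theorem inner_centeredBasisVec (i j : Fin d) :
    inner ℂ (centeredBasisVec i) (centeredBasisVec j) = (if i = j then 1 else 0) - (d : ℂ)⁻¹ := by
  have hd : (d : ℂ) ≠ 0 := Nat.cast_ne_zero.2 i.pos.ne'
  simp [centeredBasisVec, PiLp.inner_apply, mul_sub, sub_mul, Finset.sum_sub_distrib, hd,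
    apply_ite (starRingEnd ℂ), eq_comm]

theorem sum_centeredBasisVec : ∑ i : Fin d, centeredBasisVec i = 0 := by
  ext a
  have hd : (d : ℂ) ≠ 0 := Nat.cast_ne_zero.2 a.pos.ne'
  simp [centeredBasisVec, Finset.sum_sub_distrib, hd]

/-- The traceless part of the rank-one operator `x x†`, as a vector of `ℂ^(d × d)`. -/
noncomputable def centeredProjection (x : EuclideanSpace ℂ (Fin d)) :
    EuclideanSpace ℂ (Fin d × Fin d) :=
  WithLp.toLp 2 fun p =>
    x p.1 * starRingEnd ℂ (x p.2) - if p.1 = p.2 then (d : ℂ)⁻¹ else 0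

/-- In the Hilbert–Schmidt inner product `x x†` and `y y†` pair to `|⟨x, y⟩|²`; both have trace 1,
so removing the trace parts subtracts `1/d`. -/
theorem inner_centeredProjection {x y : EuclideanSpace ℂ (Fin d)} (hd : d ≠ 0) (hx : ‖x‖ = 1)
    (hy : ‖y‖ = 1) :
    inner ℂ (centeredProjection x) (centeredProjection y)
      = ((‖inner ℂ x y‖ ^ 2 - (d : ℝ)⁻¹ : ℝ) : ℂ) := by
  have hd' : (d : ℂ) ≠ 0 := Nat.cast_ne_zero.2 hd
  have hself : ∀ u : EuclideanSpace ℂ (Fin d), ‖u‖ = 1 →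
      ∑ a, u a * starRingEnd ℂ (u a) = 1 := by
    intro u hu
    have h : inner ℂ u u = 1 := by rw [inner_self_eq_norm_sq_to_K, hu]; simp
    rw [PiLp.inner_apply] at h
    exact h
  have hxy : ∑ a, ∑ b, y a * starRingEnd ℂ (y b) * (starRingEnd ℂ (x a) * x b)
      = ((‖inner ℂ x y‖ ^ 2 : ℝ) : ℂ) := by
    rw [Complex.ofReal_pow, ← Complex.mul_conj', PiLp.inner_apply, map_sum, Finset.sum_mul_sum]
    refine Finset.sum_congr rfl fun a _ => Finset.sum_congr rfl fun b _ => ?_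
    simp
    ring
  have hx' := hself x hx
  have hy' := hself y hy
  simp only [mul_comm (x.ofLp _)] at hx'
  rw [Complex.ofReal_sub, ← hxy]
  simp only [centeredProjection, PiLp.inner_apply, Fintype.sum_prod_type, RCLike.inner_apply,
    map_sub, map_mul, Complex.conj_conj, apply_ite (starRingEnd ℂ), map_zero, map_inv₀,
    map_natCast, sub_mul, mul_sub, Finset.sum_sub_distrib, mul_ite, ite_mul, zero_mul, mul_zero,
    Finset.sum_ite_eq, Finset.mem_univ, if_true, ← Finset.mul_sum, ← Finset.sum_mul, hx', hy']
  simp [hd']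

theorem VectoriallyColorable.of_isOrthogonalRep {V : Type*} {G : SimpleGraph V} (hd : 0 < d)
    {x : V → EuclideanSpace ℂ (Fin d)} (hx : G.IsOrthogonalRep d x) :
    G.VectoriallyColorable d := by
  let u : V → EuclideanSpace ℂ (Fin d) := fun v => ((‖x v‖⁻¹ : ℝ) : ℂ) • x v
  have hu : ∀ v, ‖u v‖ = 1 := fun v => by
    simp [u, norm_smul, norm_ne_zero_iff.2 (hx.ne_zero v)]
  have hadj : ∀ v w, G.Adj v w → inner ℂ (u v) (u w) = 0 := fun v w h => by
    simp [u, hx.inner_eq_zero v w h]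
  have hd0 : (0 : ℝ) < d := by exact_mod_cast hd
  -- For `d > 1` this is the solution of `1 = k (1/d) (1 - 1/d)`. That one equation yields both
  -- orthogonality conditions, since colors and projections enter the inner product symmetrically.
  -- For `d = 1` division by zero gives `k = 0`, and every vector is `(1, 0)`.
  let k : ℝ := d ^ 2 / (d - 1)
  have hk : 0 ≤ k := div_nonneg (sq_nonneg _) (sub_nonneg.2 (by exact_mod_cast hd))
  let Y : V → Fin d → EuclideanSpace ℂ (Fin d) ⊗[ℂ] EuclideanSpace ℂ (Fin d × Fin d) :=
    fun v i => ((((d : ℝ)⁻¹ * √k : ℝ) : ℂ) • centeredBasisVec i) ⊗ₜ[ℂ] centeredProjection (u v)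
  let X : V → Fin d →
      WithLp 2 (ℂ × (EuclideanSpace ℂ (Fin d) ⊗[ℂ] EuclideanSpace ℂ (Fin d × Fin d))) :=
    fun v i => WithLp.toLp 2 ((d : ℂ)⁻¹, Y v i)
  have hsum : ∀ v, ∑ i, X v i = WithLp.toLp 2 (1, 0) := by
    intro v
    have hY : ∑ i, Y v i = 0 := by
      simp only [Y]
      rw [← TensorProduct.sum_tmul, ← Finset.smul_sum, sum_centeredBasisVec, smul_zero,
        TensorProduct.zero_tmul]
    rw [← WithLp.toLp_sum]
    congr 1
    refine Prod.ext ?_ ?_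
    · simp [Prod.fst_sum, hd.ne']
    · rw [Prod.snd_sum, hY]
  have hinner : ∀ v w i j, inner ℂ (X v i) (X w j) = (((d : ℝ)⁻¹ ^ 2 * (1 + k *
      (((if i = j then 1 else 0) - (d : ℝ)⁻¹) *
        (‖inner ℂ (u v) (u w)‖ ^ 2 - (d : ℝ)⁻¹))) : ℝ) : ℂ) := by
    intro v w i j
    have hkk : ((√k : ℝ) : ℂ) * ((√k : ℝ) : ℂ) = (k : ℂ) := by
      rw [← Complex.ofReal_mul, Real.mul_self_sqrt hk]
    rw [WithLp.prod_inner_apply]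
    simp only [X, Y, TensorProduct.inner_tmul, inner_smul_left, inner_smul_right,
      inner_centeredBasisVec, inner_centeredProjection hd.ne' (hu v) (hu w), RCLike.inner_apply,
      Complex.conj_ofReal, map_inv₀, map_natCast]
    push_cast
    rw [← hkk]
    split_ifs <;> push_cast <;> ring
  have hle : ∀ v w, ‖inner ℂ (u v) (u w)‖ ^ 2 ≤ 1 := fun v w => by
    have := norm_inner_le_norm (𝕜 := ℂ) (u v) (u w)
    rw [hu, hu, one_mul] at this
    exact pow_le_one₀ (norm_nonneg _) this
  have hself : ∀ v, ‖inner ℂ (u v) (u v)‖ ^ 2 = 1 := fun v => by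
    rw [inner_self_eq_norm_sq_to_K, hu]
    simp
  have hk1 : 1 < d → k * (1 - (d : ℝ)⁻¹) = d := fun h => by
    have : (d : ℝ) - 1 ≠ 0 := sub_ne_zero.2 (by exact_mod_cast h.ne')
    simp only [k]
    field_simp
  refine ⟨_, inferInstance, inferInstance, FiniteDimensional.complete ℂ _, X, ?_, ?_, ?_, ?_, ?_⟩
  · intro v w i j
    rw [hinner, Complex.zero_le_real]
    refine mul_nonneg (by positivity) ?_
    have hp := hle v w
    generalize ‖inner ℂ (u v) (u w)‖ = p at hp
    -- For `d > 1` the bracket equals `d p²` for equal colors and `(k/d) (1 - p²)` for distinct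
    -- ones.
    split_ifs with hij
    · rcases Nat.lt_or_ge 1 d with h | h
      · rw [← mul_assoc, hk1 h, mul_sub, mul_inv_cancel₀ hd0.ne']
        nlinarith [mul_nonneg hd0.le (sq_nonneg p)]
      · obtain rfl : d = 1 := by omega
        simp
    · have h : 1 < d := by omega
      have h1 : 1 + k * ((0 - (d : ℝ)⁻¹) * (p ^ 2 - (d : ℝ)⁻¹)) = k * (d : ℝ)⁻¹ * (1 - p ^ 2) := by
        have := congrArg (· * (d : ℝ)⁻¹) (hk1 h)
        simp only [mul_inv_cancel₀ hd0.ne'] at this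
        linear_combination -this
      rw [h1]
      exact mul_nonneg (by positivity) (sub_nonneg.2 hp)
  · intro v w
    rw [hsum, hsum]
  · intro v
    rw [hsum]
    simp
  · intro v i j hij
    rw [hinner, hself, if_neg hij]
    have h : 1 < d := by omega
    have h1 : 1 + k * ((0 - (d : ℝ)⁻¹) * (1 - (d : ℝ)⁻¹)) = 0 := by
      linear_combination -(d : ℝ)⁻¹ * hk1 h - mul_inv_cancel₀ hd0.ne'
    rw [h1, mul_zero, Complex.ofReal_zero]
  · intro v w hvw i
    -- Nonzero vectors of `ℂ^1` are never orthogonal, so an edge forces `d > 1`.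
    have h : 1 < d := by
      by_contra hle1
      obtain rfl : d = 1 := by omega
      have h0 := hx.inner_eq_zero v w hvw
      rw [PiLp.inner_apply, Fin.sum_univ_one, RCLike.inner_apply, mul_eq_zero, map_eq_zero] at h0
      have hz : ∀ v, x v 0 ≠ 0 := fun v h =>
        hx.ne_zero v (PiLp.ext fun a => by rw [Subsingleton.elim a 0, h]; rfl)
      exact h0.elim (hz w) (hz v)
    have h1 : 1 + k * ((1 - (d : ℝ)⁻¹) * (0 - (d : ℝ)⁻¹)) = 0 := by
      linear_combination -(d : ℝ)⁻¹ * hk1 h - mul_inv_cancel₀ hd0.ne'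
    rw [hinner, hadj v w hvw, if_pos rfl, norm_zero, zero_pow two_ne_zero, h1, mul_zero,
      Complex.ofReal_zero]

theorem vectorialChromaticNumber_le_orthogonalRank {V : Type*} [Fintype V] [Nonempty V]
    (G : SimpleGraph V) : G.vectorialChromaticNumber ≤ G.orthogonalRank := by
  obtain ⟨hd, x, hx⟩ := Nat.sInf_mem G.exists_isOrthogonalRep
  exact Nat.sInf_le (VectoriallyColorable.of_isOrthogonalRep hd hx)

end UpperBound

end SimpleGraph

/-- For the edgeless graph all three quotients are `0 / 0`, which is read as `0`; as soon as there
is an edge, all three denominators are positive, which is the first part of the conclusion. -/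
theorem theorem2 {V : Type*} [Fintype V] [DecidableEq V] [Nonempty V]
    (G : SimpleGraph V) [DecidableRel G.Adj]
    (n m μ₁ μₙ δ₁ δₙ θ₁ : ℝ)
    (hn : n = (Fintype.card V : ℝ)) (hm : m = (G.edgeFinset.card : ℝ))
    (hμ₁ : μ₁ = G.adjEigenvalues (SimpleGraph.firstIdx V))
    (hμₙ : μₙ = G.adjEigenvalues (SimpleGraph.lastIdx V))
    (hδ₁ : δ₁ = G.signlessLapEigenvalues (SimpleGraph.firstIdx V))
    (hδₙ : δₙ = G.signlessLapEigenvalues (SimpleGraph.lastIdx V))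
    (hθ₁ : θ₁ = G.lapEigenvalues (SimpleGraph.firstIdx V)) :
    (G ≠ ⊥ → 0 < |μₙ| ∧ 0 < 2 * m - n * δₙ ∧ 0 < μ₁ - δ₁ + θ₁) ∧
    1 + max (μ₁ / |μₙ|) (max (2 * m / (2 * m - n * δₙ)) (μ₁ / (μ₁ - δ₁ + θ₁)))
      ≤ (G.vectorialChromaticNumber : ℝ) ∧
    G.vectorialChromaticNumber ≤ G.orthogonalRank := by
  have hχ : G.VectoriallyColorable G.vectorialChromaticNumber :=
    Nat.sInf_mem G.exists_vectoriallyColorable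
  generalize hχG : G.vectorialChromaticNumber = c at hχ
  have hle : c ≤ G.orthogonalRank := hχG ▸ G.vectorialChromaticNumber_le_orthogonalRank
  have hc1 : (1 : ℝ) ≤ c := by exact_mod_cast hχ.pos
  by_cases hG : G = ⊥
  · refine ⟨fun h => absurd hG h, ?_, hle⟩
    subst hG
    have hμ : μ₁ = 0 := hμ₁.trans (SimpleGraph.adjEigenvalues_bot _)
    have hm0 : m = 0 := by rw [hm]; simp
    simpa [hμ, hm0] using hc1
  · have hc2 := hχ.two_le hG
    have hc0 : (0 : ℝ) ≤ c - 1 := sub_nonneg.2 hc1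
    have hμpos : 0 < μ₁ := hμ₁ ▸ SimpleGraph.adjEigenvalues_firstIdx_pos hG
    have hmpos : 0 < 2 * m := by
      have : 0 < G.edgeFinset.card := by
        rwa [Finset.card_pos, SimpleGraph.edgeFinset_nonempty]
      rw [hm]
      positivity
    have h1 : μ₁ ≤ (c - 1) * -μₙ := hμ₁ ▸ hμₙ ▸ hχ.adjEigenvalues_le
    have h2 : 2 * m ≤ (c - 1) * (2 * m - n * δₙ) :=
      hm ▸ hn ▸ hδₙ ▸ hχ.two_mul_card_edgeFinset_le
    have h3 : μ₁ ≤ (c - 1) * (μ₁ - δ₁ + θ₁) :=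
      hμ₁ ▸ hδ₁ ▸ hθ₁ ▸ hχ.adjEigenvalues_le_mul hc2
    -- Each product bounds a positive number from above and `c - 1 ≥ 0`, so the bounds themselves
    -- force the denominators to be positive.
    have p1 := pos_of_mul_pos_right (hμpos.trans_le h1) hc0
    have p2 := pos_of_mul_pos_right (hmpos.trans_le h2) hc0
    have p3 := pos_of_mul_pos_right (hμpos.trans_le h3) hc0
    have habs : |μₙ| = -μₙ := abs_of_neg (neg_pos.1 p1)
    rw [habs]
    refine ⟨fun _ => ⟨p1, p2, p3⟩, ?_, hle⟩
    rw [← le_sub_iff_add_le']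
    exact max_le ((div_le_iff₀ p1).2 h1) (max_le ((div_le_iff₀ p2).2 h2) ((div_le_iff₀ p3).2 h3))
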